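/- Let $\sigma:\mathbb R\to\mathbb R$ be a continuous function that is not affine (not of the form $t\mapsto at+b$). An MLP $\mathbb R^m\to\mathbb R^n$ with activation $\sigma$ is a composition of affine maps with at least one hidden layer, of arbitrary widths, where $\sigma$ is applied coordinatewise after every affine map except the last. A GNN with $K$ layers for objects in $\mathbb R^d$ consists of natural numbers $d_0=d,d_1,\dots,d_K$ and MLPs $\mathrm{MLP}_1^{(k)}:\mathbb R^{d_{k-1}}\times\mathbb R^{d_{k-1}}\to\mathbb R^{d_k}$ ($1\le k\le K$) and $\mathrm{MLP}_2:\mathbb R^{d_K}\to\mathbb R$ with activation $\sigma$. On a finite set $S$ of objects, where $s\in S$ is represented by a vector $X_s\in\mathbb R^d$ (different objects may have equal vectors), it outputs $$h_S=\mathrm{MLP}_2\Big(\sum_{s\in S}h_s^{(K)}\Big),\qquad h_s^{(0)}=X_s,\qquad h_s^{(k)}=\sum_{t\in S}\mathrm{MLP}_1^{(k)}\big(h_s^{(k-1)},h_t^{(k-1)}\big)\quad(1\le k\le K).$$ **Proposition.** Let $d,N\ge 0$ be integers, let $C\subset\mathbb R^d$ be compact, and let $f$ be a real-valued function of at most $N$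 elements of $C$, that is, a family of functions $f_n:C^n\to\mathbb R$, $0\le n\le N$. Suppose that every $f_n$ is continuous and permutation-invariant: $f_n(X_{\pi(1)},\dots,X_{\pi(n)})=f_n(X_1,\dots,X_n)$ for all $(X_1,\dots,X_n)\in C^n$ and all permutations $\pi$ of $\{1,\dots,n\}$. Then for every integer $K\ge 1$ and every $\varepsilon>0$ there is a GNN with exactly $K$ layers such that, for all $0\le n\le N$ and all $(X_1,\dots,X_n)\in C^n$, its output $h_S$ on the $n$ objects represented by $X_1,\dots,X_n$ satisfies $$\big|h_S-f_n(X_1,\dots,X_n)\big|<\varepsilon .$$ -/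

import Mathlib

namespace SetGNN

/-- The parameters (weight matrix and bias vector) of an affine map from `ℝ^m` to `ℝ^n`. -/
structure Affine (m n : ℕ) where
  weight : Matrix (Fin n) (Fin m) ℝ
  bias : Fin n → ℝ

/-- The affine map `x ↦ W x + b`. -/
def Affine.eval {m n : ℕ} (A : Affine m n) (x : Fin m → ℝ) : Fin n → ℝ :=
  A.weight.mulVec x + A.bias

/-- The parameters of a multi-layer perceptron from `ℝ^m` to `ℝ^n`: at least one hidden layer,
arbitrarily many hidden layers, arbitrary hidden widths, and an affine output layer. -/
inductive MLP : ℕ → ℕ → Type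
  /-- One hidden layer of width `w`, followed by the affine output layer. -/
  | oneHidden {m w n : ℕ} (hid : Affine m w) (out : Affine w n) : MLP m n
  /-- A hidden layer of width `w`, followed by an MLP on its activations. -/
  | moreHidden {m w n : ℕ} (hid : Affine m w) (rest : MLP w n) : MLP m n

/-- The function computed by an MLP with activation `σ`, applied coordinatewise after every
hidden affine map. -/
def MLP.eval (σ : ℝ → ℝ) : {m n : ℕ} → MLP m n → (Fin m → ℝ) → (Fin n → ℝ)
  | _, _, .oneHidden hid out, x => out.eval (fun i => σ (hid.eval x i))
  | _, _, .moreHidden hid rest, x => rest.eval σ (fun i => σ (hid.eval x i))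

/-- The parameters of `K` successive message passing iterations, which turn object representations
in `ℝ^d` into object representations in `ℝ^e`. Iteration `k` has its own MLP, whose input is a
pair of representations (so has twice their dimension). -/
inductive MessagePassing : ℕ → ℕ → ℕ → Type
  | done (d : ℕ) : MessagePassing 0 d d
  | step {K d m e : ℕ} (first : MLP (d + d) m) (rest : MessagePassing K m e) :
      MessagePassing (K + 1) d e

/-- Starting from representations `h s`, apply
`h' s = ∑ t, MLP₁ (h s, h t)` successively for all iterations; the sum is over all objects `t`,
including `s` itself. -/
def MessagePassing.eval (σ : ℝ → ℝ) {S : Type*} [Fintype S] :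
    {K d e : ℕ} → MessagePassing K d e → (S → Fin d → ℝ) → (S → Fin e → ℝ)
  | _, _, _, .done _, h => h
  | _, _, _, .step first rest, h =>
      rest.eval σ (fun s => ∑ t, first.eval σ (Fin.append (h s) (h t)))

/-- The parameters of a real-valued graph neural network with `K` layers (message passing
iterations) on the complete graph, for objects represented by vectors in `ℝ^d`. -/
structure GNN (d K : ℕ) where
  /-- The dimension of the object representations after the last iteration. -/
  dim : ℕ
  messages : MessagePassing K d dim
  readout : MLP dim 1

/-- The answer `MLP₂ (∑ s, h_s^(K))` of the network on a universe `S` whose object `s` is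
represented by `X s`. -/
def GNN.eval (σ : ℝ → ℝ) {d K : ℕ} (G : GNN d K) {S : Type*} [Fintype S]
    (X : S → Fin d → ℝ) : ℝ :=
  G.readout.eval σ (∑ s, G.messages.eval σ X s) 0

end SetGNN

/-!
The proof reduces everything to polynomials.

*Universal approximation.* Since `σ` is continuous and not affine, some second difference of `σ`
is nonzero. Averaging `σ` twice gives a `C²` function that is still a uniform limit of combinations
of neurons and has a nonzero second derivative somewhere, so rescaled second differences of it
converge to the square function (`exists_neuron_sum_near_sq`). Hence a single hidden layer
approximates coordinatewise squares, and by polarization coordinatewise products of affine maps.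
Composing such layers evaluates polynomials like a straight-line program, in which each layer keeps
the whole previous state and appends one product (`MLPApprox.polynomial`). Arbitrary depth is
essential here, because `σ` may itself be a polynomial.

*Message passing.* If the first message is a function `φ` of the receiving object and later
messages repeat its representation, then `K` iterations produce `n ^ K • φ (X s)`, so the network
computes `Q (n ^ K • ∑ s, φ (X s))` up to a small error (`exists_gnn_near`).

*Symmetric functions.* The numbers `n ^ K * ∑ s, q (X s)`, for all polynomials `q`, determine `n`
(take `q = 1`) and the multiplicity of every point (take `q` to be the indicator of one of the
finitely many points involved), hence the tuple up to a permutation. On the compact space of tuples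
modulo permutations they separate points, and by Stone-Weierstrass every continuous symmetric
function is close to a polynomial `Q` in finitely many of them (`exists_polynomial_near`).
-/

namespace SetGNN

/-! ### Approximating the square function by neurons -/

/-- A continuous function all of whose symmetric second differences vanish is affine. -/
theorem exists_affine_of_second_difference_eq_zero {σ : ℝ → ℝ} (hσ : Continuous σ)
    (h : ∀ x k : ℝ, σ (x + 2 * k) - 2 * σ (x + k) + σ x = 0) :
    ∃ a b : ℝ, ∀ t : ℝ, σ t = a * t + b := by
  let τ : ℝ →+ ℝ :=
    { toFun := fun x => σ x - σ 0
      map_zero' := by simp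
      map_add' := fun x y => by
        have h₁ := h 0 ((x + y) / 2)
        have h₂ := h x ((y - x) / 2)
        rw [show (0 : ℝ) + 2 * ((x + y) / 2) = x + y by ring,
          show (0 : ℝ) + (x + y) / 2 = (x + y) / 2 by ring] at h₁
        rw [show x + 2 * ((y - x) / 2) = y by ring,
          show x + (y - x) / 2 = (x + y) / 2 by ring] at h₂
        linarith }
  have hτ : Continuous τ := hσ.sub continuous_const
  refine ⟨τ 1, σ 0, fun t => ?_⟩
  have h₁ : τ (t • (1 : ℝ)) = t • τ 1 := map_real_smul τ hτ t 1
  have h₂ : τ t = σ t - σ 0 := rfl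
  rw [smul_eq_mul, smul_eq_mul, mul_one, h₂] at h₁
  linarith

/-- If `U'` is differentiable at `b`, then the symmetric second difference of `U` at `b` is
`U''(b) y ^ 2 + o(y ^ 2)`. -/
theorem exists_abs_second_difference_sub_le {U U' : ℝ → ℝ} {b c : ℝ}
    (hU : ∀ x, HasDerivAt U (U' x) x) (hU' : HasDerivAt U' c b) {ε : ℝ} (hε : 0 < ε) :
    ∃ δ > 0, ∀ y : ℝ, |y| ≤ δ → |U (b + y) + U (b - y) - 2 * U b - c * y ^ 2| ≤ ε * y ^ 2 := by
  have h₁ := (hasDerivAt_iff_isLittleO.1 hU').def (half_pos hε)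
  obtain ⟨δ, hδ, hball⟩ := Metric.eventually_nhds_iff.1 h₁
  refine ⟨δ / 2, half_pos hδ, fun y hy => ?_⟩
  let g : ℝ → ℝ := fun z => U (b + z) + U (b - z) - 2 * U b - c * z ^ 2
  have hg : ∀ z, HasDerivAt g (U' (b + z) - U' (b - z) - 2 * c * z) z := fun z => by
    have e₁ : HasDerivAt (fun z => U (b + z)) (U' (b + z)) z := (hU (b + z)).comp_const_add b z
    have e₂ : HasDerivAt (fun z => U (b - z)) (-U' (b - z)) z := (hU (b - z)).comp_const_sub b z
    have e₃ : HasDerivAt (fun z : ℝ => c * z ^ 2) (c * (2 * z)) z := by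
      simpa using (hasDerivAt_pow 2 z).const_mul c
    exact ((e₁.add e₂).sub_const (2 * U b) |>.sub e₃).congr_deriv (by ring)
  have hbound : ∀ z ∈ Set.Icc (-|y|) |y|,
      ‖U' (b + z) - U' (b - z) - 2 * c * z‖ ≤ ε * |y| := fun z hz => by
    have hz' : |z| ≤ |y| := abs_le.2 hz
    have hzδ : |z| < δ := by linarith
    have e₁ := hball (y := b + z) (by simpa [Real.dist_eq] using hzδ)
    have e₂ := hball (y := b - z) (by simpa [Real.dist_eq] using hzδ)
    simp only [Real.norm_eq_abs, smul_eq_mul, add_sub_cancel_left, sub_sub_cancel_left,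
      abs_neg] at e₁ e₂
    rw [Real.norm_eq_abs]
    have e₃ : U' (b + z) - U' (b - z) - 2 * c * z
        = (U' (b + z) - U' b - z * c) - (U' (b - z) - U' b - -z * c) := by ring
    rw [e₃]
    refine (abs_sub _ _).trans ?_
    nlinarith
  have hmv := (convex_Icc (-|y|) |y|).norm_image_sub_le_of_norm_hasDerivWithin_le
    (fun z _ => (hg z).hasDerivWithinAt) hbound (x := 0) (y := y)
    (by simp) ⟨neg_abs_le y, le_abs_self y⟩
  have hg0 : g 0 = 0 := by simp only [g]; ring_nf
  rw [hg0, sub_zero, sub_zero, Real.norm_eq_abs, Real.norm_eq_abs, mul_assoc, abs_mul_abs_self] at hmv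
  rw [pow_two y]
  simpa [g, pow_two] using hmv

/-- The neuron `x ↦ σ (w x + b)` on `[-R, R]`, as a continuous function of its parameters
`(w, b)`. -/
noncomputable def neuron {σ : ℝ → ℝ} (hσ : Continuous σ) (R : ℝ) :
    C(ℝ × ℝ, C(Set.Icc (-R) R, ℝ)) :=
  ContinuousMap.curry ⟨fun p => σ (p.1.1 * p.2 + p.1.2), by fun_prop⟩

/-- The uniform closure on `[-R, R]` of the linear combinations of neurons. -/
noncomputable def neuronSpan {σ : ℝ → ℝ} (hσ : Continuous σ) (R : ℝ) :
    Submodule ℝ C(Set.Icc (-R) R, ℝ) :=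
  (Submodule.span ℝ (Set.range (neuron hσ R))).topologicalClosure

theorem integral_mem_of_isClosed {E : Type*} [NormedAddCommGroup E] [NormedSpace ℝ E]
    [CompleteSpace E] {S : Submodule ℝ E} (hS : IsClosed (S : Set E)) {F : ℝ → E}
    (hF : Continuous F) (hmem : ∀ t, F t ∈ S) (a b : ℝ) : ∫ t in a..b, F t ∈ S := by
  have : CompleteSpace S := hS.completeSpace_coe
  -- integrate in the Banach space `S` and apply the inclusion
  have hF' : Continuous fun t => (⟨F t, hmem t⟩ : S) := hF.subtype_mk hmem
  have h := S.subtypeL.intervalIntegral_comp_comm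
    (hF'.intervalIntegrable (μ := MeasureTheory.volume) a b)
  exact h ▸ Subtype.property _

/-- Averaging `σ` twice over an interval of length `h` gives a `C²` function `U` in the closed span
of the neurons, whose second derivative is the second difference of `σ` with step `h`. Where it
does not vanish, a rescaled second difference of `U` is close to the square function. -/
theorem exists_neuron_sum_near_sq {σ : ℝ → ℝ} (hσ : Continuous σ)
    (hσ' : ¬ ∃ a b : ℝ, ∀ t : ℝ, σ t = a * t + b) (R : ℝ) {ε : ℝ} (hε : 0 < ε) :
    ∃ (r : ℕ) (c w b : Fin r → ℝ), ∀ x : ℝ, |x| ≤ R →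
      |∑ j, c j * σ (w j * x + b j) - x ^ 2| ≤ ε := by
  obtain ⟨b, h, hne⟩ : ∃ b h : ℝ, σ (b + 2 * h) - 2 * σ (b + h) + σ b ≠ 0 := by
    by_contra! hcon
    exact hσ' (exists_affine_of_second_difference_eq_zero hσ hcon)
  set c := σ (b + 2 * h) - 2 * σ (b + h) + σ b with hc
  let S : ℝ → ℝ := fun x => ∫ t in (0 : ℝ)..h, σ (x + t)
  let U : ℝ → ℝ := fun x => ∫ t in (0 : ℝ)..h, S (x + t)
  -- a moving average is a difference of values of a primitive
  have hderiv : ∀ g : ℝ → ℝ, Continuous g → ∀ x,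
      HasDerivAt (fun x => ∫ t in (0 : ℝ)..h, g (x + t)) (g (x + h) - g x) x := by
    intro g hg x
    have e : ∀ x, ∫ t in (0 : ℝ)..h, g (x + t)
        = (∫ t in (0 : ℝ)..(x + h), g t) - ∫ t in (0 : ℝ)..x, g t := fun x => by
      rw [intervalIntegral.integral_comp_add_left, add_zero,
        intervalIntegral.integral_interval_sub_left (hg.intervalIntegrable _ _)
          (hg.intervalIntegrable _ _)]
    simp_rw [e]
    have e' : ∀ x, HasDerivAt (fun x => ∫ t in (0 : ℝ)..x, g t) (g x) x := fun x =>
      hg.integral_hasStrictDerivAt 0 x |>.hasDerivAt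
    exact ((e' (x + h)).comp_add_const x h).sub (e' x)
  have hS := hderiv σ hσ
  have hScont : Continuous S := continuous_iff_continuousAt.2 fun x => (hS x).continuousAt
  have hU := hderiv S hScont
  have hU' : HasDerivAt (fun x => S (x + h) - S x) c b := by
    refine (((hS (b + h)).comp_add_const b h).sub (hS b)).congr_deriv ?_
    rw [hc, show b + h + h = b + 2 * h by ring]
    ring
  -- the doubly averaged neuron lies in the closed span of the neurons
  have hmem : ∀ p : ℝ × ℝ, ∃ F ∈ neuronSpan hσ R, ∀ x, F x = U (p.1 * x + p.2) := by
    intro p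
    have hcl : IsClosed (neuronSpan hσ R : Set C(Set.Icc (-R) R, ℝ)) :=
      Submodule.isClosed_topologicalClosure _
    let F₁ : ℝ → C(Set.Icc (-R) R, ℝ) := fun t =>
      ∫ s in (0 : ℝ)..h, neuron hσ R (p.1, p.2 + t + s)
    have hn : Continuous fun q : ℝ × ℝ => neuron hσ R (p.1, p.2 + q.1 + q.2) :=
      (neuron hσ R).continuous.comp (by fun_prop)
    have hF₁ : Continuous F₁ :=
      intervalIntegral.continuous_parametric_intervalIntegral_of_continuous' hn 0 h
    have hF₁mem : ∀ t, F₁ t ∈ neuronSpan hσ R := fun t =>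
      integral_mem_of_isClosed hcl (hn.comp (by fun_prop : Continuous fun s : ℝ => (t, s)))
        (fun s => Submodule.le_topologicalClosure _ (Submodule.subset_span ⟨_, rfl⟩)) 0 h
    refine ⟨∫ t in (0 : ℝ)..h, F₁ t, integral_mem_of_isClosed hcl hF₁ hF₁mem 0 h, fun x => ?_⟩
    have ev : ∀ F : ℝ → C(Set.Icc (-R) R, ℝ), Continuous F →
        (∫ t in (0 : ℝ)..h, F t) x = ∫ t in (0 : ℝ)..h, F t x := fun F hF =>
      ((ContinuousMap.evalCLM ℝ x).intervalIntegral_comp_comm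
        (hF.intervalIntegrable (μ := MeasureTheory.volume) 0 h)).symm
    rw [ev F₁ hF₁]
    refine intervalIntegral.integral_congr fun t _ => ?_
    refine (ev _ (hn.comp (by fun_prop : Continuous fun s : ℝ => (t, s)))).trans ?_
    refine intervalIntegral.integral_congr fun s _ => ?_
    change σ (p.1 * x + (p.2 + t + s)) = σ (p.1 * x + p.2 + t + s)
    congr 1
    ring
  obtain ⟨δ, hδ, hUδ⟩ := exists_abs_second_difference_sub_le (U := U) hU hU'
    (ε := |c| * (ε / 2) / (R ^ 2 + 1)) (by positivity)
  -- the scale `w` moves the whole interval into the `δ`-neighbourhood of `b`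
  set w : ℝ := δ / (|R| + 1) with hw
  have hwpos : 0 < w := by positivity
  obtain ⟨Fp, hFp, hFp'⟩ := hmem (w, b)
  obtain ⟨Fm, hFm, hFm'⟩ := hmem (-w, b)
  obtain ⟨Fz, hFz, hFz'⟩ := hmem (0, b)
  have hFmem : (c * w ^ 2)⁻¹ • (Fp + Fm - (2 : ℝ) • Fz) ∈ neuronSpan hσ R :=
    Submodule.smul_mem _ _ (Submodule.sub_mem _ (Submodule.add_mem _ hFp hFm)
      (Submodule.smul_mem _ _ hFz))
  obtain ⟨G, hG, hGF⟩ := Metric.mem_closure_iff.1 hFmem (ε / 2) (half_pos hε)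
  obtain ⟨r, cf, v, hv⟩ := (Submodule.mem_span_set' (R := ℝ)).1 hG
  choose q hq using fun i => (v i).2
  refine ⟨r, cf, fun i => (q i).1, fun i => (q i).2, fun x hx => ?_⟩
  have hx' := abs_le.1 hx
  let x' : Set.Icc (-R) R := ⟨x, hx'⟩
  have hGx : ∑ j, cf j * σ ((q j).1 * x + (q j).2) = G x' := by
    rw [← hv, ContinuousMap.sum_apply]
    refine Finset.sum_congr rfl fun j _ => ?_
    rw [← hq]
    rfl
  have h₁ : |G x' - (c * w ^ 2)⁻¹ * (U (b + w * x) + U (b - w * x) - 2 * U b)| ≤ ε / 2 := by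
    have e : ((c * w ^ 2)⁻¹ • (Fp + Fm - (2 : ℝ) • Fz)) x'
        = (c * w ^ 2)⁻¹ * (U (b + w * x) + U (b - w * x) - 2 * U b) := by
      change (c * w ^ 2)⁻¹ * (Fp x' + Fm x' - 2 * Fz x') = _
      rw [hFp' x', hFm' x', hFz' x']
      simp only [x']
      rw [show w * x + b = b + w * x by ring, show -w * x + b = b - w * x by ring,
        show 0 * x + b = b by ring]
    rw [← e, abs_sub_comm, ← Real.dist_eq]
    exact (ContinuousMap.dist_apply_le_dist x').trans hGF.le
  have hwx : |w * x| ≤ δ := by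
    rw [abs_mul, abs_of_pos hwpos, hw, div_mul_eq_mul_div, div_le_iff₀ (by positivity)]
    have : |x| ≤ |R| + 1 := by linarith [le_abs_self R]
    gcongr
  have h₂ := hUδ (w * x) hwx
  have h₃ : |(c * w ^ 2)⁻¹ * (U (b + w * x) + U (b - w * x) - 2 * U b) - x ^ 2| ≤ ε / 2 := by
    have e : (c * w ^ 2)⁻¹ * (U (b + w * x) + U (b - w * x) - 2 * U b) - x ^ 2
        = (c * w ^ 2)⁻¹ * (U (b + w * x) + U (b - w * x) - 2 * U b - c * (w * x) ^ 2) := by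
      field_simp
    rw [e, abs_mul, abs_inv, abs_mul, abs_of_pos (pow_pos hwpos 2)]
    have hxR : x ^ 2 ≤ R ^ 2 + 1 := by nlinarith
    have hcpos : 0 < |c| := abs_pos.2 hne
    refine (mul_le_mul_of_nonneg_left h₂ (by positivity)).trans ?_
    rw [show (|c| * w ^ 2)⁻¹ * (|c| * (ε / 2) / (R ^ 2 + 1) * (w * x) ^ 2)
      = ε / 2 * (x ^ 2 / (R ^ 2 + 1)) by field_simp]
    exact mul_le_of_le_one_right (by positivity) ((div_le_one (by positivity)).2 hxR)
  rw [hGx]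
  linarith [abs_sub_le (G x') ((c * w ^ 2)⁻¹ * (U (b + w * x) + U (b - w * x) - 2 * U b)) (x ^ 2)]

/-! ### Composition of MLPs -/

/-- The composite `B ∘ A` of two parametrized affine maps. -/
def Affine.comp {m n p : ℕ} (B : Affine n p) (A : Affine m n) : Affine m p :=
  ⟨B.weight * A.weight, B.weight.mulVec A.bias + B.bias⟩

theorem Affine.eval_comp {m n p : ℕ} (B : Affine n p) (A : Affine m n) (x : Fin m → ℝ) :
    (B.comp A).eval x = B.eval (A.eval x) := by
  simp only [Affine.eval, Affine.comp, Matrix.mulVec_add, Matrix.mulVec_mulVec, add_assoc]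

theorem Affine.exists_eval_eq {m n : ℕ} (ℓ : (Fin m → ℝ) →ᵃ[ℝ] (Fin n → ℝ)) :
    ∃ A : Affine m n, ∀ x, A.eval x = ℓ x :=
  ⟨⟨LinearMap.toMatrix' ℓ.linear, ℓ 0⟩, fun x => by
    rw [Affine.eval, LinearMap.toMatrix'_mulVec]
    exact (congrFun ℓ.decomp x).symm⟩

/-- Precomposition of an MLP with an affine map, absorbed by its first hidden layer. -/
def MLP.precomp {l : ℕ} : {m n : ℕ} → MLP m n → Affine l m → MLP l n
  | _, _, .oneHidden hid out, A => .oneHidden (hid.comp A) out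
  | _, _, .moreHidden hid rest, A => .moreHidden (hid.comp A) rest

theorem MLP.eval_precomp (σ : ℝ → ℝ) {l m n : ℕ} (M : MLP m n) (A : Affine l m)
    (x : Fin l → ℝ) : (M.precomp A).eval σ x = M.eval σ (A.eval x) := by
  cases M <;> simp only [MLP.precomp, MLP.eval, Affine.eval_comp]

/-- Postcomposition of an MLP with an affine map, absorbed by its output layer. -/
def MLP.postcomp {p : ℕ} : {m n : ℕ} → MLP m n → Affine n p → MLP m p
  | _, _, .oneHidden hid out, B => .oneHidden hid (B.comp out)
  | _, _, .moreHidden hid rest, B => .moreHidden hid (rest.postcomp B)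

theorem MLP.eval_postcomp (σ : ℝ → ℝ) {m n p : ℕ} (M : MLP m n) (B : Affine n p)
    (x : Fin m → ℝ) : (M.postcomp B).eval σ x = B.eval (M.eval σ x) := by
  induction M with
  | oneHidden hid out => simp only [MLP.postcomp, MLP.eval, Affine.eval_comp]
  | moreHidden hid rest ih => simp only [MLP.postcomp, MLP.eval, ih]

/-- The composite of two MLPs; the output layer of the inner one is merged with the first hidden
layer of the outer one. -/
def MLP.comp {p : ℕ} : {m n : ℕ} → MLP n p → MLP m n → MLP m p
  | _, _, M, .oneHidden hid out => .moreHidden hid (M.precomp out)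
  | _, _, M, .moreHidden hid rest => .moreHidden hid (M.comp rest)

theorem MLP.eval_comp (σ : ℝ → ℝ) {m n p : ℕ} (M : MLP n p) (M' : MLP m n)
    (x : Fin m → ℝ) : (M.comp M').eval σ x = M.eval σ (M'.eval σ x) := by
  induction M' with
  | oneHidden hid out => simp only [MLP.comp, MLP.eval, MLP.eval_precomp]
  | moreHidden hid rest ih => simp only [MLP.comp, MLP.eval, ih]

/-! ### Approximation of continuous maps on balls -/

section Bounds

variable {E F : Type*} [NormedAddCommGroup E] [ProperSpace E] [NormedAddCommGroup F]

theorem exists_norm_le_of_continuous {g : E → F} (hg : Continuous g) (R : ℝ) :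
    ∃ B, 0 ≤ B ∧ ∀ x, ‖x‖ ≤ R → ‖g x‖ ≤ B := by
  obtain ⟨B, hB⟩ := (isCompact_closedBall (0 : E) R).exists_bound_of_continuousOn hg.continuousOn
  exact ⟨max B 0, le_max_right _ _, fun x hx => (hB x (by simpa using hx)).trans (le_max_left _ _)⟩

theorem exists_modulus_of_continuous {g : E → F} (hg : Continuous g) (R : ℝ) {ε : ℝ}
    (hε : 0 < ε) :
    ∃ δ, 0 < δ ∧ δ ≤ 1 ∧ ∀ x y, ‖x‖ ≤ R → ‖y - x‖ ≤ δ → ‖g y - g x‖ ≤ ε := by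
  have h := (isCompact_closedBall (0 : E) R).uniformContinuousAt_of_continuousAt g
    (fun a _ => hg.continuousAt) (Metric.dist_mem_uniformity hε)
  obtain ⟨δ, hδ, h⟩ := Metric.mem_uniformity_dist.1 h
  refine ⟨min (δ / 2) 1, by positivity, min_le_right _ _, fun x y hx hy => ?_⟩
  have hxy : dist x y < δ := by
    rw [dist_comm, dist_eq_norm]
    linarith [min_le_left (δ / 2) 1]
  have h' := h hxy (by simpa using hx)
  rw [← dist_eq_norm, dist_comm]
  exact h'.le

end Bounds

/-! ### Universal approximation of polynomial maps -/

/-- A continuous map is MLP-approximable if MLPs with activation `σ` come arbitrarily close to it,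
uniformly on every ball. -/
def MLPApprox (σ : ℝ → ℝ) {m n : ℕ} (g : (Fin m → ℝ) → Fin n → ℝ) : Prop :=
  Continuous g ∧ ∀ R ε : ℝ, 0 < ε →
    ∃ M : MLP m n, ∀ x, ‖x‖ ≤ R → ‖M.eval σ x - g x‖ ≤ ε

namespace MLPApprox

variable {σ : ℝ → ℝ} {m n p : ℕ}

theorem comp {g : (Fin n → ℝ) → Fin p → ℝ} {f : (Fin m → ℝ) → Fin n → ℝ}
    (hg : MLPApprox σ g) (hf : MLPApprox σ f) : MLPApprox σ (fun x => g (f x)) := by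
  refine ⟨hg.1.comp hf.1, fun R ε hε => ?_⟩
  obtain ⟨B, -, hB⟩ := exists_norm_le_of_continuous hf.1 R
  obtain ⟨δ, hδ, hδ1, hmod⟩ := exists_modulus_of_continuous hg.1 B (half_pos hε)
  obtain ⟨M, hM⟩ := hf.2 R δ hδ
  obtain ⟨M', hM'⟩ := hg.2 (B + 1) (ε / 2) (half_pos hε)
  refine ⟨M'.comp M, fun x hx => ?_⟩
  rw [MLP.eval_comp]
  have h₁ := hmod (f x) (M.eval σ x) (hB x hx) (hM x hx)
  have h₂ := hM' (M.eval σ x) (by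
    have := norm_sub_norm_le (M.eval σ x) (f x)
    linarith [hM x hx, hB x hx])
  linarith [norm_sub_le_norm_sub_add_norm_sub (M'.eval σ (M.eval σ x)) (g (M.eval σ x)) (g (f x))]

theorem affine_comp (ℓ : (Fin n → ℝ) →ᵃ[ℝ] (Fin p → ℝ)) {f : (Fin m → ℝ) → Fin n → ℝ}
    (hf : MLPApprox σ f) : MLPApprox σ (fun x => ℓ (f x)) := by
  have hℓ := ℓ.continuous_of_finiteDimensional
  refine ⟨hℓ.comp hf.1, fun R ε hε => ?_⟩
  obtain ⟨B, -, hB⟩ := exists_norm_le_of_continuous hf.1 R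
  obtain ⟨δ, hδ, -, hmod⟩ := exists_modulus_of_continuous hℓ B hε
  obtain ⟨M, hM⟩ := hf.2 R δ hδ
  obtain ⟨A, hA⟩ := Affine.exists_eval_eq ℓ
  refine ⟨M.postcomp A, fun x hx => ?_⟩
  rw [MLP.eval_postcomp, hA]
  exact hmod _ _ (hB x hx) (hM x hx)

theorem comp_affine {g : (Fin n → ℝ) → Fin p → ℝ} (hg : MLPApprox σ g)
    (ℓ : (Fin m → ℝ) →ᵃ[ℝ] (Fin n → ℝ)) : MLPApprox σ (fun x => g (ℓ x)) := by
  have hℓ := ℓ.continuous_of_finiteDimensional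
  refine ⟨hg.1.comp hℓ, fun R ε hε => ?_⟩
  obtain ⟨B, -, hB⟩ := exists_norm_le_of_continuous hℓ R
  obtain ⟨M, hM⟩ := hg.2 B ε hε
  obtain ⟨A, hA⟩ := Affine.exists_eval_eq ℓ
  refine ⟨M.precomp A, fun x hx => ?_⟩
  rw [MLP.eval_precomp, hA]
  exact hM _ (hB x hx)

/-- The coordinatewise square is MLP-approximable: every coordinate gets its own copy of the
neurons whose combination is close to the square function. -/
theorem sq (hσ : Continuous σ) (hσ' : ¬ ∃ a b : ℝ, ∀ t : ℝ, σ t = a * t + b) (n : ℕ) :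
    MLPApprox σ (fun (x : Fin n → ℝ) i => x i ^ 2) := by
  refine ⟨by fun_prop, fun R ε hε => ?_⟩
  obtain ⟨r, c, w, b, h⟩ := exists_neuron_sum_near_sq hσ hσ' R hε
  let e : Fin n × Fin r ≃ Fin (n * r) := finProdFinEquiv
  let hid : Affine n (n * r) :=
    ⟨fun k i => if (e.symm k).1 = i then w (e.symm k).2 else 0, fun k => b (e.symm k).2⟩
  let out : Affine (n * r) n :=
    ⟨fun i k => if (e.symm k).1 = i then c (e.symm k).2 else 0, 0⟩
  refine ⟨.oneHidden hid out, fun x hx => (pi_norm_le_iff_of_nonneg hε.le).2 fun i => ?_⟩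
  have hhid : ∀ k, hid.eval x k = w (e.symm k).2 * x (e.symm k).1 + b (e.symm k).2 := fun k => by
    simp [hid, Affine.eval, Matrix.mulVec, dotProduct, ite_mul]
  have hout : MLP.eval σ (.oneHidden hid out) x i = ∑ j, c j * σ (w j * x i + b j) := by
    simp only [MLP.eval, hhid]
    simp only [out, Affine.eval, Matrix.mulVec, dotProduct, ite_mul, zero_mul, add_zero]
    rw [← e.sum_comp, Fintype.sum_prod_type]
    simp
  rw [Pi.sub_apply, hout]
  exact h (x i) ((norm_le_pi_norm x i).trans hx)

/-- Coordinatewise products of affine maps, by polarization: `4 a b = (a + b)² - (a - b)²`. -/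
theorem mul_affine (hσ : Continuous σ) (hσ' : ¬ ∃ a b : ℝ, ∀ t : ℝ, σ t = a * t + b)
    (α β : (Fin m → ℝ) →ᵃ[ℝ] (Fin n → ℝ)) : MLPApprox σ (fun x => α x * β x) := by
  let pre : (Fin m → ℝ) →ᵃ[ℝ] (Fin (n + n) → ℝ) := AffineMap.pi
    (Fin.addCases (fun i => (AffineMap.proj i).comp (α + β))
      (fun i => (AffineMap.proj i).comp (α - β)))
  let coord (k : Fin (n + n)) : (Fin (n + n) → ℝ) →ᵃ[ℝ] ℝ := AffineMap.proj k
  let post : (Fin (n + n) → ℝ) →ᵃ[ℝ] (Fin n → ℝ) := AffineMap.pi fun i =>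
    (1 / 4 : ℝ) • (coord (Fin.castAdd n i) - coord (Fin.natAdd n i))
  convert ((sq hσ hσ' (n + n)).comp_affine pre).affine_comp post using 1
  funext x i
  have h₁ : pre x (Fin.castAdd n i) = α x i + β x i := by simp [pre]
  have h₂ : pre x (Fin.natAdd n i) = α x i - β x i := by
    simp only [pre, AffineMap.pi_apply, Fin.addCases_right]
    rfl
  have h₃ : ∀ z, post z i = 1 / 4 * (z (Fin.castAdd n i) - z (Fin.natAdd n i)) := fun z => rfl
  rw [h₃, h₁, h₂, Pi.mul_apply]
  ring

theorem id (hσ : Continuous σ) (hσ' : ¬ ∃ a b : ℝ, ∀ t : ℝ, σ t = a * t + b) (n : ℕ) :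
    MLPApprox σ (fun x : Fin n → ℝ => x) := by
  simpa using mul_affine hσ hσ' (AffineMap.id ℝ (Fin n → ℝ)) (AffineMap.const ℝ _ 1)

/-- Straight-line programs: starting from an approximable state `g` that contains the
coordinates, the state can be enlarged by products so that it contains a given polynomial. Here a
state contains every function that is affine in it. -/
theorem exists_state_eval (hσ : Continuous σ)
    (hσ' : ¬ ∃ a b : ℝ, ∀ t : ℝ, σ t = a * t + b) (q : MvPolynomial (Fin m) ℝ) :
    ∀ {k : ℕ} {g : (Fin m → ℝ) → Fin k → ℝ}, MLPApprox σ g →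
      (∃ π : (Fin k → ℝ) →ᵃ[ℝ] (Fin m → ℝ), ∀ x, π (g x) = x) →
      ∃ (k' : ℕ) (g' : (Fin m → ℝ) → Fin k' → ℝ), MLPApprox σ g' ∧
        (∃ ρ : (Fin k' → ℝ) →ᵃ[ℝ] (Fin k → ℝ), ∀ x, ρ (g' x) = g x) ∧
        ∃ ℓ : (Fin k' → ℝ) →ᵃ[ℝ] ℝ, ∀ x, ℓ (g' x) = MvPolynomial.eval x q := by
  induction q using MvPolynomial.induction_on with
  | C a =>
    intro k g hg _
    exact ⟨k, g, hg, ⟨AffineMap.id ℝ _, fun _ => rfl⟩, AffineMap.const ℝ _ a, by simp⟩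
  | add q₁ q₂ ih₁ ih₂ =>
    intro k g hg ⟨π, hπ⟩
    obtain ⟨k₁, g₁, hg₁, ⟨ρ₁, hρ₁⟩, ℓ₁, hℓ₁⟩ := ih₁ hg ⟨π, hπ⟩
    obtain ⟨k₂, g₂, hg₂, ⟨ρ₂, hρ₂⟩, ℓ₂, hℓ₂⟩ :=
      ih₂ hg₁ ⟨π.comp ρ₁, fun x => by simp [hρ₁, hπ]⟩
    exact ⟨k₂, g₂, hg₂, ⟨ρ₁.comp ρ₂, fun x => by simp [hρ₁, hρ₂]⟩, ℓ₁.comp ρ₂ + ℓ₂,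
      fun x => by simp [hρ₂, hℓ₁, hℓ₂]⟩
  | mul_X q i ih =>
    intro k g hg ⟨π, hπ⟩
    obtain ⟨k₁, g₁, hg₁, ⟨ρ₁, hρ₁⟩, ℓ₁, hℓ₁⟩ := ih hg ⟨π, hπ⟩
    -- the new state is the coordinatewise product of `(q, g₁)` and `(x i, 1)`
    let α : (Fin k₁ → ℝ) →ᵃ[ℝ] (Fin (k₁ + 1) → ℝ) :=
      AffineMap.pi (Fin.cases ℓ₁ fun j => AffineMap.proj j)
    let β : (Fin k₁ → ℝ) →ᵃ[ℝ] (Fin (k₁ + 1) → ℝ) :=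
      AffineMap.pi (Fin.cases ((AffineMap.proj i).comp (π.comp ρ₁)) fun _ => AffineMap.const ℝ _ 1)
    refine ⟨k₁ + 1, fun x => α (g₁ x) * β (g₁ x), (mul_affine hσ hσ' α β).comp hg₁,
      ⟨ρ₁.comp (AffineMap.pi fun j => AffineMap.proj j.succ), fun x => ?_⟩,
      AffineMap.proj 0, fun x => ?_⟩
    · rw [AffineMap.comp_apply, ← hρ₁]
      congr 1
      funext j
      simp [α, β]
    · simp [α, β, hℓ₁, hρ₁, hπ]

/-- Polynomial maps are MLP-approximable. -/
theorem polynomial (hσ : Continuous σ) (hσ' : ¬ ∃ a b : ℝ, ∀ t : ℝ, σ t = a * t + b)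
    (q : Fin n → MvPolynomial (Fin m) ℝ) :
    MLPApprox σ (fun x i => MvPolynomial.eval x (q i)) := by
  suffices h : ∃ (k : ℕ) (g : (Fin m → ℝ) → Fin k → ℝ), MLPApprox σ g ∧
      (∃ π : (Fin k → ℝ) →ᵃ[ℝ] (Fin m → ℝ), ∀ x, π (g x) = x) ∧
      ∃ ℓ : (Fin k → ℝ) →ᵃ[ℝ] (Fin n → ℝ), ∀ x i, ℓ (g x) i = MvPolynomial.eval x (q i) by
    obtain ⟨k, g, hg, -, ℓ, hℓ⟩ := h
    convert hg.affine_comp ℓ using 1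
    funext x i
    exact (hℓ x i).symm
  induction n with
  | zero =>
    exact ⟨m, fun x => x, id hσ hσ' m, ⟨AffineMap.id ℝ _, fun _ => rfl⟩,
      AffineMap.const ℝ _ 0, fun _ i => i.elim0⟩
  | succ n ih =>
    obtain ⟨k, g, hg, ⟨π, hπ⟩, ℓ, hℓ⟩ := ih fun i => q i.succ
    obtain ⟨k', g', hg', ⟨ρ, hρ⟩, ℓ', hℓ'⟩ := exists_state_eval hσ hσ' (q 0) hg ⟨π, hπ⟩
    refine ⟨k', g', hg', ⟨π.comp ρ, fun x => by simp [hρ, hπ]⟩,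
      AffineMap.pi (Fin.cases ℓ' fun i => (AffineMap.proj i).comp (ℓ.comp ρ)), fun x i => ?_⟩
    cases i using Fin.cases with
    | zero => simp [hℓ']
    | succ i => simp [hρ, hℓ]

end MLPApprox

/-! ### Message passing -/

/-- `K` message passing iterations can turn the representation `X s` on universes of `n` objects
into approximately `n ^ K • φ (X s)`, uniformly for `n ≤ N` and bounded representations. The
factor `n ^ K` arises because a message that ignores the sending object is received `n` times. -/
def MessageApprox (σ : ℝ → ℝ) (K : ℕ) {d e : ℕ} (φ : (Fin d → ℝ) → Fin e → ℝ) : Prop :=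
  ∀ (N : ℕ) (R ε : ℝ), 0 < ε → ∃ G : MessagePassing K d e, ∀ n ≤ N, ∀ X : Fin n → Fin d → ℝ,
    (∀ s, ‖X s‖ ≤ R) → ∀ s, ‖G.eval σ X s - (n : ℝ) ^ K • φ (X s)‖ ≤ ε

theorem MessageApprox.done (σ : ℝ → ℝ) (d : ℕ) : MessageApprox σ 0 (fun x : Fin d → ℝ => x) :=
  fun N R ε hε => ⟨.done d, fun n _ X _ s => by simpa [MessagePassing.eval] using hε.le⟩

theorem MessageApprox.step {σ : ℝ → ℝ} {K d e : ℕ} {φ : (Fin d → ℝ) → Fin e → ℝ}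
    (hφ : MLPApprox σ φ) (hK : MessageApprox σ K (fun x : Fin e → ℝ => x)) :
    MessageApprox σ (K + 1) φ := by
  intro N R ε hε
  obtain ⟨B, hB0, hB⟩ := exists_norm_le_of_continuous hφ.1 R
  obtain ⟨G, hG⟩ := hK N (N * (B + 1)) (ε / 2) (half_pos hε)
  set δ : ℝ := min 1 (ε / 2 / ((N : ℝ) ^ (K + 1) + 1)) with hδ
  have hδpos : 0 < δ := by positivity
  have hδN : (N : ℝ) ^ (K + 1) * δ ≤ ε / 2 := by
    have h₁ : δ ≤ ε / 2 / ((N : ℝ) ^ (K + 1) + 1) := min_le_right _ _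
    rw [le_div_iff₀ (by positivity)] at h₁
    nlinarith
  -- the message is `φ` of the receiving object
  let fst : (Fin (d + d) → ℝ) →ᵃ[ℝ] (Fin d → ℝ) := AffineMap.pi fun i =>
    AffineMap.proj (Fin.castAdd d i)
  obtain ⟨M, hM⟩ := (hφ.comp_affine fst).2 R δ hδpos
  refine ⟨.step M G, fun n hn X hX s => ?_⟩
  have hR : 0 ≤ R := (norm_nonneg _).trans (hX s)
  have hnN : (n : ℝ) ≤ N := by exact_mod_cast hn
  have hmsg : ∀ s t, ‖M.eval σ (Fin.append (X s) (X t)) - φ (X s)‖ ≤ δ := fun s t => by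
    have h₁ : ‖Fin.append (X s) (X t)‖ ≤ R := (pi_norm_le_iff_of_nonneg hR).2 fun i => by
      refine Fin.addCases (fun i => ?_) (fun i => ?_) i
      · rw [Fin.append_left]
        exact (norm_le_pi_norm _ i).trans (hX s)
      · rw [Fin.append_right]
        exact (norm_le_pi_norm _ i).trans (hX t)
    have h₂ : fst (Fin.append (X s) (X t)) = X s := by
      funext i
      exact Fin.append_left (X s) (X t) i
    simpa only [h₂] using hM _ h₁
  let H : Fin n → Fin e → ℝ := fun s => ∑ t, M.eval σ (Fin.append (X s) (X t))
  have hH : ∀ s, ‖H s - (n : ℝ) • φ (X s)‖ ≤ n * δ := fun s => by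
    have h₁ : H s - (n : ℝ) • φ (X s)
        = ∑ t : Fin n, (M.eval σ (Fin.append (X s) (X t)) - φ (X s)) := by
      rw [Finset.sum_sub_distrib, Finset.sum_const, Finset.card_univ, Fintype.card_fin,
        Nat.cast_smul_eq_nsmul]
    rw [h₁]
    refine (norm_sum_le_of_le _ fun t _ => hmsg s t).trans (by simp)
  have hHbound : ∀ s, ‖H s‖ ≤ N * (B + 1) := fun s => by
    have h₁ : ∀ t, ‖M.eval σ (Fin.append (X s) (X t))‖ ≤ B + 1 := fun t => by
      have := norm_sub_norm_le (M.eval σ (Fin.append (X s) (X t))) (φ (X s))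
      linarith [hmsg s t, hB _ (hX s), min_le_left 1 (ε / 2 / ((N : ℝ) ^ (K + 1) + 1))]
    refine (norm_sum_le_of_le _ fun t _ => h₁ t).trans ?_
    rw [Finset.sum_const, Finset.card_univ, Fintype.card_fin, nsmul_eq_mul]
    gcongr
  have h₁ := hG n hn H hHbound s
  have h₂ : ‖(n : ℝ) ^ K • H s - (n : ℝ) ^ (K + 1) • φ (X s)‖ ≤ ε / 2 := by
    rw [pow_succ, mul_smul, ← smul_sub, norm_smul, norm_pow, Real.norm_natCast]
    calc (n : ℝ) ^ K * ‖H s - (n : ℝ) • φ (X s)‖ ≤ (n : ℝ) ^ K * (n * δ) := by gcongr; exact hH s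
      _ = (n : ℝ) ^ (K + 1) * δ := by ring
      _ ≤ (N : ℝ) ^ (K + 1) * δ := by gcongr
      _ ≤ ε / 2 := hδN
  change ‖G.eval σ H s - (n : ℝ) ^ (K + 1) • φ (X s)‖ ≤ ε
  linarith [norm_sub_le_norm_sub_add_norm_sub (G.eval σ H s) ((n : ℝ) ^ K • H s)
    ((n : ℝ) ^ (K + 1) • φ (X s))]

/-- One iteration applies `φ`; the remaining `K` iterations only pass representations on. -/
theorem messageApprox_succ {σ : ℝ → ℝ} (hσ : Continuous σ)
    (hσ' : ¬ ∃ a b : ℝ, ∀ t : ℝ, σ t = a * t + b) (K : ℕ) {d e : ℕ}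
    {φ : (Fin d → ℝ) → Fin e → ℝ} (hφ : MLPApprox σ φ) : MessageApprox σ (K + 1) φ := by
  refine .step hφ ?_
  clear hφ
  induction K with
  | zero => exact .done σ e
  | succ K ih => exact .step (MLPApprox.id hσ hσ' e) ih

/-- GNNs with `K + 1` layers approximate every function `Q (n ^ (K + 1) ∑ s, φ (X s))` with
approximable `φ` and `Q`. -/
theorem exists_gnn_near {σ : ℝ → ℝ} (hσ : Continuous σ)
    (hσ' : ¬ ∃ a b : ℝ, ∀ t : ℝ, σ t = a * t + b) (K : ℕ) {d e : ℕ}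
    {φ : (Fin d → ℝ) → Fin e → ℝ} (hφ : MLPApprox σ φ) {Q : (Fin e → ℝ) → Fin 1 → ℝ}
    (hQ : MLPApprox σ Q) (N : ℕ) (R : ℝ) {ε : ℝ} (hε : 0 < ε) :
    ∃ G : GNN d (K + 1), ∀ n ≤ N, ∀ X : Fin n → Fin d → ℝ, (∀ s, ‖X s‖ ≤ R) →
      |G.eval σ X - Q ((n : ℝ) ^ (K + 1) • ∑ s, φ (X s)) 0| ≤ ε := by
  obtain ⟨B, hB0, hB⟩ := exists_norm_le_of_continuous hφ.1 R
  set B' : ℝ := (N : ℝ) ^ (K + 1) * (N * B) with hB'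
  obtain ⟨δ, hδ, hδ1, hmod⟩ := exists_modulus_of_continuous hQ.1 B' (half_pos hε)
  obtain ⟨G, hG⟩ := messageApprox_succ hσ hσ' K hφ N R (δ / (N + 1)) (by positivity)
  obtain ⟨M, hM⟩ := hQ.2 (B' + 1) (ε / 2) (half_pos hε)
  refine ⟨⟨e, G, M⟩, fun n hn X hX => ?_⟩
  have hnN : (n : ℝ) ≤ N := by exact_mod_cast hn
  set y := (n : ℝ) ^ (K + 1) • ∑ s, φ (X s) with hy
  set z := ∑ s, G.eval σ X s with hz
  have hyB : ‖y‖ ≤ B' := by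
    rw [hy, norm_smul, norm_pow, Real.norm_natCast, hB']
    have : ‖∑ s, φ (X s)‖ ≤ N * B := by
      refine (norm_sum_le_of_le _ fun s _ => hB _ (hX s)).trans ?_
      rw [Finset.sum_const, Finset.card_univ, Fintype.card_fin, nsmul_eq_mul]
      gcongr
    gcongr
  have hzy : ‖z - y‖ ≤ δ := by
    rw [hz, hy, Finset.smul_sum, ← Finset.sum_sub_distrib]
    refine (norm_sum_le_of_le _ fun s _ => hG n hn X hX s).trans ?_
    rw [Finset.sum_const, Finset.card_univ, Fintype.card_fin, nsmul_eq_mul, mul_div_assoc',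
      div_le_iff₀ (by positivity)]
    nlinarith
  have h₁ := hmod y z hyB hzy
  have h₂ := hM z (by linarith [norm_sub_norm_le z y])
  change ‖M.eval σ z 0 - Q y 0‖ ≤ ε
  refine (norm_le_pi_norm (M.eval σ z - Q y) 0).trans ?_
  linarith [norm_sub_le_norm_sub_add_norm_sub (M.eval σ z) (Q z) (Q y)]

/-! ### Symmetric functions and sums of polynomial features -/

/-- Polynomials separate a point from finitely many others. -/
theorem exists_mvPolynomial_eval_eq_indicator {d : ℕ} (c : Fin d → ℝ) (T : Finset (Fin d → ℝ)) :
    ∃ q : MvPolynomial (Fin d) ℝ, MvPolynomial.eval c q = 1 ∧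
      ∀ x ∈ T, x ≠ c → MvPolynomial.eval x q = 0 := by
  classical
  induction T using Finset.induction_on with
  | empty => exact ⟨1, by simp, by simp⟩
  | insert a T ha ih =>
    obtain ⟨q, hqc, hq⟩ := ih
    by_cases hac : a = c
    · exact ⟨q, hqc, fun x hx hxc => hq x (by
        rcases Finset.mem_insert.1 hx with rfl | hx
        · exact absurd hac hxc
        · exact hx) hxc⟩
    obtain ⟨i, hi⟩ := Function.ne_iff.1 hac
    refine ⟨q * (MvPolynomial.C (c i - a i)⁻¹ * (MvPolynomial.X i - MvPolynomial.C (a i))),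
      ?_, fun x hx hxc => ?_⟩
    · simp [hqc, inv_mul_cancel₀ (sub_ne_zero.2 (Ne.symm hi))]
    · rcases Finset.mem_insert.1 hx with rfl | hx
      · simp
      · simp [hq x hx hxc]

/-- Two tuples with the same sums of polynomials are permutations of each other: the polynomial
sums determine the multiplicity of every point. -/
theorem exists_perm_of_sum_eval_eq {d n : ℕ} {X Y : Fin n → Fin d → ℝ}
    (h : ∀ q : MvPolynomial (Fin d) ℝ,
      ∑ s, MvPolynomial.eval (X s) q = ∑ s, MvPolynomial.eval (Y s) q) :
    ∃ π : Equiv.Perm (Fin n), ∀ s, Y (π s) = X s := by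
  classical
  have hcard : ∀ c, Fintype.card {s // X s = c} = Fintype.card {s // Y s = c} := fun c => by
    obtain ⟨q, hqc, hq⟩ := exists_mvPolynomial_eval_eq_indicator c
      (Finset.univ.image X ∪ Finset.univ.image Y)
    have key : ∀ Z : Fin n → Fin d → ℝ,
        (∀ s, Z s ∈ Finset.univ.image X ∪ Finset.univ.image Y) →
        ∑ s, MvPolynomial.eval (Z s) q = Fintype.card {s // Z s = c} := fun Z hZ => by
      rw [Fintype.card_subtype, Finset.card_filter, Nat.cast_sum]
      refine Finset.sum_congr rfl fun s _ => ?_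
      split_ifs with hs
      · rw [hs, hqc, Nat.cast_one]
      · rw [hq _ (hZ s) hs, Nat.cast_zero]
    have := h q
    rw [key X (by simp), key Y (by simp)] at this
    exact_mod_cast this
  refine ⟨(Equiv.sigmaFiberEquiv X).symm.trans ((Equiv.sigmaCongrRight fun c =>
    Fintype.equivOfCardEq (hcard c)).trans (Equiv.sigmaFiberEquiv Y)), fun s => ?_⟩
  exact (Fintype.equivOfCardEq (hcard (X s)) ⟨s, rfl⟩).2

/-- A continuous symmetric function of at most `N` points of a compact set is uniformly close to a
polynomial in finitely many of the features `n ^ K ∑ s, φ (X s)`, with `φ` polynomial. -/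
theorem exists_polynomial_near {d N : ℕ} {C : Set (Fin d → ℝ)} (hC : IsCompact C)
    {f : (n : ℕ) → (Fin n → Fin d → ℝ) → ℝ}
    (hf_cont : ∀ n ≤ N, ContinuousOn (f n) {X | ∀ i, X i ∈ C})
    (hf_perm : ∀ n ≤ N, ∀ X : Fin n → Fin d → ℝ, (∀ i, X i ∈ C) →
      ∀ π : Equiv.Perm (Fin n), f n (fun i => X (π i)) = f n X)
    (K : ℕ) {ε : ℝ} (hε : 0 < ε) :
    ∃ (e : ℕ) (φ : Fin e → MvPolynomial (Fin d) ℝ) (Q : MvPolynomial (Fin e) ℝ),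
      ∀ n ≤ N, ∀ X : Fin n → Fin d → ℝ, (∀ i, X i ∈ C) →
        |MvPolynomial.eval ((n : ℝ) ^ K • ∑ s, fun i => MvPolynomial.eval (X s) (φ i)) Q
          - f n X| < ε := by
  have : CompactSpace C := isCompact_iff_compactSpace.1 hC
  let Y := Σ n : Fin (N + 1), (Fin n → C)
  let feat : MvPolynomial (Fin d) ℝ → Y → ℝ := fun q y =>
    (y.1 : ℝ) ^ K * ∑ s, MvPolynomial.eval (y.2 s : Fin d → ℝ) q
  have hfeat : ∀ q, Continuous (feat q) := fun q => continuous_sigma fun n => by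
    have hs : ∀ s : Fin n, Continuous fun X : Fin n → C =>
        MvPolynomial.eval (X s : Fin d → ℝ) q := fun s => (MvPolynomial.continuous_eval q).comp
      (continuous_subtype_val.comp (continuous_apply s))
    have hsum := continuous_finsetSum Finset.univ fun s _ => hs s
    exact hsum.const_mul ((n : ℝ) ^ K)
  let F : Y → ℝ := fun y => f y.1 fun s => y.2 s
  have hF : Continuous F := continuous_sigma fun n =>
    (hf_cont n (Nat.lt_succ_iff.1 n.2)).comp_continuous
      (continuous_pi fun s => continuous_subtype_val.comp (continuous_apply s)) fun X i => (X i).2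
  -- on the quotient by equality of all features, the features separate points
  let r : Setoid Y := Setoid.ker fun y q => feat q y
  have hFr : ∀ y z, r y z → F y = F z := by
    rintro ⟨n, X⟩ ⟨m, Z⟩ hyz
    have hq : ∀ q, feat q ⟨n, X⟩ = feat q ⟨m, Z⟩ := congrFun hyz
    -- the feature of the constant polynomial `1` is `n ^ (K + 1)`, which determines `n`
    obtain rfl : n = m := by
      have h₁ := hq 1
      simp only [feat, map_one, Finset.sum_const, Finset.card_univ, Fintype.card_fin, nsmul_eq_mul,
        mul_one, ← pow_succ] at h₁
      have h₂ : ((n : ℕ) : ℝ) = (m : ℕ) :=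
        (pow_left_inj₀ (by positivity) (by positivity) K.succ_ne_zero).1 h₁
      exact Fin.ext (by exact_mod_cast h₂)
    -- for `n = 0` the factor `n ^ K` may vanish, but then both sums are empty
    have hsum : ∀ q, ∑ s, MvPolynomial.eval (X s : Fin d → ℝ) q
        = ∑ s, MvPolynomial.eval (Z s : Fin d → ℝ) q := fun q => by
      rcases Nat.eq_zero_or_pos (n : ℕ) with h0 | hpos
      · have : IsEmpty (Fin (n : ℕ)) := by rw [h0]; infer_instance
        simp
      · exact mul_left_cancel₀ (pow_ne_zero K (by exact_mod_cast hpos.ne')) (hq q)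
    obtain ⟨π, hπ⟩ := exists_perm_of_sum_eval_eq hsum
    simp only [F]
    rw [← hf_perm n (Nat.lt_succ_iff.1 n.2) (fun s => Z s) (fun s => (Z s).2) π]
    simp only [hπ]
  let feat' : MvPolynomial (Fin d) ℝ → C(Quotient r, ℝ) := fun q =>
    ⟨Quotient.lift (feat q) fun _ _ h => congrFun h q, (hfeat q).quotient_lift _⟩
  let F' : Quotient r → ℝ := Quotient.lift F hFr
  have hF' : Continuous F' := hF.quotient_lift hFr
  have hsep : (Algebra.adjoin ℝ (Set.range feat')).SeparatesPoints := by
    intro y z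
    induction y using Quotient.inductionOn with | _ y
    induction z using Quotient.inductionOn with | _ z
    intro hyz
    have : ∃ q, feat q y ≠ feat q z := by
      by_contra! hcon
      exact hyz (Quotient.sound (funext hcon))
    obtain ⟨q, hq⟩ := this
    exact ⟨feat' q, ⟨feat' q, Algebra.subset_adjoin ⟨q, rfl⟩, rfl⟩, hq⟩
  obtain ⟨⟨g, hg⟩, hgF⟩ :=
    ContinuousMap.exists_mem_subalgebra_near_continuous_of_separatesPoints _ hsep F' hF' ε hε
  rw [Algebra.adjoin_range_eq_range_aeval] at hg
  obtain ⟨P, rfl⟩ := hg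
  obtain ⟨e, φ, -, Q, rfl⟩ := P.exists_fin_rename
  refine ⟨e, φ, Q, fun n hn X hX => ?_⟩
  let y : Y := ⟨⟨n, Nat.lt_succ_iff.2 hn⟩, fun s => ⟨X s, hX s⟩⟩
  have h := hgF (Quotient.mk r y)
  have h₁ : (MvPolynomial.aeval feat' (MvPolynomial.rename φ Q)) (Quotient.mk r y)
      = MvPolynomial.eval ((n : ℝ) ^ K • ∑ s, fun i => MvPolynomial.eval (X s) (φ i)) Q := by
    have ev := MvPolynomial.comp_aeval_apply (f := feat' ∘ φ)
      (ContinuousMap.evalAlgHom ℝ ℝ (Quotient.mk r y)) Q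
    rw [MvPolynomial.aeval_rename]
    refine ev.trans ((RingHom.congr_fun (MvPolynomial.coe_aeval_eq_eval _) Q).trans ?_)
    congr 2
    funext i
    rw [Pi.smul_apply, Finset.sum_apply]
    rfl
  rw [Real.norm_eq_abs] at h
  exact h₁ ▸ h

end SetGNN

theorem proposition3p1
    (σ : ℝ → ℝ) (hσ : Continuous σ)
    (hσ_nonlin : ¬ ∃ a b : ℝ, ∀ t : ℝ, σ t = a * t + b)
    (d N : ℕ) (C : Set (Fin d → ℝ)) (hC : IsCompact C)
    (f : (n : ℕ) → (Fin n → Fin d → ℝ) → ℝ)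
    (hf_cont : ∀ n ≤ N, ContinuousOn (f n) {X | ∀ i, X i ∈ C})
    (hf_perm : ∀ n ≤ N, ∀ X : Fin n → Fin d → ℝ, (∀ i, X i ∈ C) →
      ∀ π : Equiv.Perm (Fin n), f n (fun i => X (π i)) = f n X)
    (K : ℕ) (hK : 1 ≤ K) (ε : ℝ) (hε : 0 < ε) :
    ∃ G : SetGNN.GNN d K, ∀ n ≤ N, ∀ X : Fin n → Fin d → ℝ, (∀ i, X i ∈ C) →
      |G.eval σ X - f n X| < ε := by
  obtain ⟨K, rfl⟩ := Nat.exists_eq_add_of_le' hK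
  obtain ⟨R, hR⟩ := hC.isBounded.exists_norm_le
  obtain ⟨e, φ, Q, hQ⟩ := SetGNN.exists_polynomial_near hC hf_cont hf_perm (K + 1) (half_pos hε)
  obtain ⟨G, hG⟩ := SetGNN.exists_gnn_near hσ hσ_nonlin K
    (SetGNN.MLPApprox.polynomial hσ hσ_nonlin φ)
    (SetGNN.MLPApprox.polynomial hσ hσ_nonlin fun _ => Q) N R (half_pos hε)
  refine ⟨G, fun n hn X hX => ?_⟩
  have h₁ := hG n hn X fun s => hR _ (hX s)
  have h₂ := hQ n hn X hX
  linarith [abs_sub_le (G.eval σ X) (MvPolynomial.eval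
    ((n : ℝ) ^ (K + 1) • ∑ s, fun i => MvPolynomial.eval (X s) (φ i)) Q) (f n X)]
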